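/- **Conventions.** Let $X$ be the set of finite binary strings, $|s|$ the length of $s\in X$, and, for an infinite binary sequence $\alpha$, let $\alpha_n$ be its prefix of length $n$. A *computer* is a partial recursive function $C\colon X\to X$ with prefix-free domain; $H_C(s)=\min\{|p| : C(p)=s\}$ ($\infty$ if there is no such $p$). Fix any computer $U$ that is optimal: for each computer $C$ there is a constant $\mathrm{sim}(C)$ such that for every $p$ in the domain of $C$ there is $q$ with $U(q)=C(p)$ and $|q|\le |p|+\mathrm{sim}(C)$. Put $H=H_U$. For a real $d$, an infinite binary sequence $\alpha$ is: *$d$-compressible* if $H(\alpha_n)\le dn+o(n)$; *Chaitin $d$-random* if $\lim_{n\to\infty} (H(\alpha_n)-dn)=\infty$; *weakly Chaitin $d$-random* if there is $c\in\mathbb R$ with $dn-c\le H(\alpha_n)$ for all $n$; *semi $d$-random* if $d\le\liminf_{n\to\infty} H(\alpha_n)/n$. Let $N\ge 1$. A point $x=(x^1,\dots,x^N)\in\mathbb R^N$ is identified with the sequence $x^1_1x^2_1\cdots x^N_1\,x^1_2x^2_2\cdots x^N_2\cdots$, where $0.x^i_1x^i_2\cdots$ is the base-two expansion with infinitely many zeros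 of $x^i \bmod 1=x^i-\lfloor x^i\rfloor$. For $F\subset\mathbb R^N$ and $D\in\mathbb R$, we say that $\dim_{Ak}F$ exists and equals $D$ ($k=1,2,3,4$) if every $x\in F$ is $\frac DN$-compressible and, moreover: for $k=1$, some $x\in F$ is Chaitin $\frac DN$-random; for $k=2$, some $x\in F$ is weakly Chaitin $\frac DN$-random; for $k=3$, some $x\in F$ is semi $\frac DN$-random; for $k=4$, for every real $d<\frac DN$ some $x\in F$ is Chaitin $d$-random. (There is at most one such $D$.) For $s\in X$ let $I(s)=[0.s,\,0.s+2^{-|s|})$ and $\hat I(s)=[0.s-2^{-|s|},\,0.s+2\cdot 2^{-|s|})\bmod 1$, and let $F\bmod 1$ be the set of coordinatewise fractional parts of the points of $F$. Let $\mathfrak M(F)$ (resp. $\hat{\mathfrak M}(F)$) be the set of $(s_1,\dots,s_N)\in X^N$ with $|s_1|=\dots=|s_N|$ such that $I(s_1)\times\dots\times I(s_N)$ (resp. $\hat I(s_1)\times\dots\times\hat I(s_N)$) meets $F\bmod 1$. The set $F$ satisfies the *r.e. condition* if there is a recursively enumerable set $L\subset X^N$ with $\mathfrak M(F)\subset L\subset\hat{\mathfrak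 M}(F)$. Let $\mathcal H^D$ be the $D$-dimensional Hausdorff outer measure on $\mathbb R^N$ (Euclidean distance), $\dim_H$ the Hausdorff dimension, and $\overline{\dim}_B F=\limsup_{\delta\to 0+}\frac{\log N_\delta(F)}{-\log\delta}$ the upper box-counting dimension, where $N_\delta(F)$ is the least number of closed balls of radius $\delta$ that cover $F$. A real $D$ is *computable* if a base-two expansion of $D\bmod 1$ is given by a total recursive function. **Theorem.** Let $F\subset\mathbb R^N$ be non-empty and bounded. Suppose that $F$ satisfies the r.e. condition and that $\dim_H F=\overline{\dim}_B F$. Let $D=\dim_H F$. (a) $\dim_{A4}F$ exists and $\dim_{A4}F=D$. (b) If $\mathcal H^D(F)>0$, then $\dim_{A3}F$ exists and $\dim_{A3}F=D$. (c) If $\mathcal H^D(F)>0$ and $D$ is a computable real number, then $\dim_{A1}F$ and $\dim_{A2}F$ both exist and $\dim_{A1}F=\dim_{A2}F=D$. -/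

import Mathlib

open Filter Topology MeasureTheory
open scoped NNReal ENNReal

namespace AlgDim

/-! ### Prefix-free machines and program-size complexity -/

/-- The domain of a partial function on finite binary strings. -/
def Dom (C : List Bool →. List Bool) : Set (List Bool) := {p | (C p).Dom}

/-- A *computer*: a partial recursive function on finite binary strings whose domain is
prefix-free. -/
def IsComputer (C : List Bool →. List Bool) : Prop :=
  Partrec C ∧ ∀ p ∈ Dom C, ∀ q ∈ Dom C, p <+: q → p = q

/-- A computer that simulates every computer with a constant overhead in program length. -/
def IsOptimalComputer (U : List Bool →. List Bool) : Prop :=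
  IsComputer U ∧ ∀ C : List Bool →. List Bool, IsComputer C →
    ∃ sim : ℕ, ∀ p s, s ∈ C p → ∃ q, s ∈ U q ∧ q.length ≤ p.length + sim

/-- `H_C(s)`: the length of a shortest program for `s`, and `∞` if there is none. -/
noncomputable def complexity (C : List Bool →. List Bool) (s : List Bool) : ℕ∞ :=
  ⨅ (p : List Bool) (_ : s ∈ C p), (p.length : ℕ∞)

/-- `H_C(s)` as an extended real number. -/
noncomputable def complexityE (C : List Bool →. List Bool) (s : List Bool) : EReal :=
  ((complexity C s : ℝ≥0∞) : EReal)

/-! ### Infinite binary sequences: degrees of randomness and compressibility -/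

/-- The prefix of length `n` of an infinite binary sequence. -/
def pre (α : ℕ → Bool) (n : ℕ) : List Bool := (List.range n).map α

/-- `∃ c, ∀ n, d n - c ≤ H(α_n)`. -/
def IsWeaklyChaitinRandom (U : List Bool →. List Bool) (d : ℝ) (α : ℕ → Bool) : Prop :=
  ∃ c : ℝ, ∀ n : ℕ, ((d * n - c : ℝ) : EReal) ≤ complexityE U (pre α n)

/-- `H(α_n) - d n → ∞`. -/
def IsChaitinRandom (U : List Bool →. List Bool) (d : ℝ) (α : ℕ → Bool) : Prop :=
  Tendsto (fun n : ℕ => complexityE U (pre α n) - ((d * n : ℝ) : EReal)) atTop (𝓝 ⊤)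

/-- `d ≤ liminf H(α_n) / n`. -/
def IsSemiRandom (U : List Bool →. List Bool) (d : ℝ) (α : ℕ → Bool) : Prop :=
  (d : EReal) ≤ liminf (fun n : ℕ => complexityE U (pre α n) / ((n : ℝ) : EReal)) atTop

/-- `H(α_n) ≤ d n + o(n)`. -/
def IsCompressible (U : List Bool →. List Bool) (d : ℝ) (α : ℕ → Bool) : Prop :=
  ∃ f : ℕ → ℝ, Tendsto (fun n : ℕ => f n / n) atTop (𝓝 0) ∧
    ∀ n : ℕ, complexityE U (pre α n) ≤ ((d * n + f n : ℝ) : EReal)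

/-! ### Points of Euclidean space as infinite binary sequences -/

/-- The interleaved binary digits `x¹₁ x²₁ … x^N₁ x¹₂ x²₂ … x^N₂ …` of the fractional parts of the
coordinates of `x`; `Real.digits` gives the expansion with infinitely many zeros. -/
noncomputable def code {N : ℕ} [NeZero N] (x : EuclideanSpace ℝ (Fin N)) : ℕ → Bool :=
  fun m => decide (Real.digits (Int.fract (x (Fin.ofNat N m))) 2 (m / N) = 1)

/-! ### Algorithmic dimensions

`IsAlgDimk U F D` says that the `k`-th algorithmic dimension of `F` exists and is `D`. -/

/-- The first algorithmic dimension of `F` exists and equals `D`. -/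
def IsAlgDim1 (U : List Bool →. List Bool) {N : ℕ} [NeZero N]
    (F : Set (EuclideanSpace ℝ (Fin N))) (D : ℝ) : Prop :=
  (∀ x ∈ F, IsCompressible U (D / N) (code x)) ∧ ∃ x ∈ F, IsChaitinRandom U (D / N) (code x)

/-- The second algorithmic dimension of `F` exists and equals `D`. -/
def IsAlgDim2 (U : List Bool →. List Bool) {N : ℕ} [NeZero N]
    (F : Set (EuclideanSpace ℝ (Fin N))) (D : ℝ) : Prop :=
  (∀ x ∈ F, IsCompressible U (D / N) (code x)) ∧
    ∃ x ∈ F, IsWeaklyChaitinRandom U (D / N) (code x)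

/-- The third algorithmic dimension of `F` exists and equals `D`. -/
def IsAlgDim3 (U : List Bool →. List Bool) {N : ℕ} [NeZero N]
    (F : Set (EuclideanSpace ℝ (Fin N))) (D : ℝ) : Prop :=
  (∀ x ∈ F, IsCompressible U (D / N) (code x)) ∧ ∃ x ∈ F, IsSemiRandom U (D / N) (code x)

/-- The fourth algorithmic dimension of `F` exists and equals `D`. -/
def IsAlgDim4 (U : List Bool →. List Bool) {N : ℕ} [NeZero N]
    (F : Set (EuclideanSpace ℝ (Fin N))) (D : ℝ) : Prop :=
  (∀ x ∈ F, IsCompressible U (D / N) (code x)) ∧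
    ∀ d : ℝ, d < D / N → ∃ x ∈ F, IsChaitinRandom U d (code x)

/-! The four notions are well defined: each determines the number `D`. -/

theorem IsChaitinRandom.eventually_le {U : List Bool →. List Bool} {d : ℝ} {α : ℕ → Bool}
    (h : IsChaitinRandom U d α) :
    ∀ᶠ n : ℕ in atTop, ((d * n : ℝ) : EReal) ≤ complexityE U (pre α n) := by
  filter_upwards [h.eventually (lt_mem_nhds (EReal.coe_lt_top 0))] with n hn
  by_contra hlt
  push Not at hlt
  have hle : complexityE U (pre α n) - ((d * n : ℝ) : EReal) ≤ 0 :=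
    EReal.sub_nonpos.2 hlt.le
  exact absurd hn (by simpa using hle)

/-- A compressible sequence of rate `a` is not random of degree `d > a`. -/
theorem IsCompressible.le_of_eventually {U : List Bool →. List Bool} {a d c : ℝ} {α : ℕ → Bool}
    (ha : IsCompressible U a α)
    (hd : ∀ᶠ n : ℕ in atTop, ((d * n - c : ℝ) : EReal) ≤ complexityE U (pre α n)) : d ≤ a := by
  obtain ⟨f, hf, hle⟩ := ha
  have h1 : Tendsto (fun n : ℕ => a + f n / n + c / n) atTop (𝓝 (a + 0 + 0)) :=
    (tendsto_const_nhds.add hf).add (tendsto_const_div_atTop_nhds_zero_nat c)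
  rw [add_zero, add_zero] at h1
  refine ge_of_tendsto h1 ?_
  filter_upwards [hd, eventually_gt_atTop 0] with n hn hpos
  have h2 : d * n - c ≤ a * n + f n := EReal.coe_le_coe_iff.1 (hn.trans (hle n))
  have h3 : (0 : ℝ) < n := Nat.cast_pos.2 hpos
  have h4 : a + f n / n + c / n = (a * n + f n + c) / n := by field_simp
  rw [h4, le_div_iff₀ h3]
  linarith

theorem IsCompressible.le_of_semiRandom {U : List Bool →. List Bool} {a d : ℝ} {α : ℕ → Bool}
    (ha : IsCompressible U a α) (hd : IsSemiRandom U d α) : d ≤ a := by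
  refine le_of_forall_lt fun e he => ?_
  obtain ⟨e', hee', he'd⟩ := exists_between he
  refine hee'.trans_le (ha.le_of_eventually (c := 0) ?_)
  have h := eventually_lt_of_lt_liminf (lt_of_lt_of_le (EReal.coe_lt_coe_iff.2 he'd) hd)
  filter_upwards [h, eventually_gt_atTop 0] with n hn hpos
  have h3 : (0 : EReal) < ((n : ℝ) : EReal) := EReal.coe_pos.2 (Nat.cast_pos.2 hpos)
  have := (EReal.le_div_iff_mul_le h3 (EReal.coe_ne_top _)).1 hn.le
  simpa using this

theorem IsAlgDim1.unique {U : List Bool →. List Bool} {N : ℕ} [NeZero N]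
    {F : Set (EuclideanSpace ℝ (Fin N))} {D D' : ℝ}
    (h : IsAlgDim1 U F D) (h' : IsAlgDim1 U F D') : D = D' := by
  have hN : (0 : ℝ) < N := Nat.cast_pos.2 (NeZero.pos N)
  have key : ∀ {A B : ℝ}, IsAlgDim1 U F A → IsAlgDim1 U F B → B ≤ A := by
    rintro A B ⟨hA, -⟩ ⟨-, x, hx, hB⟩
    exact (div_le_div_iff_of_pos_right hN).1
      ((hA x hx).le_of_eventually (c := 0) (by simpa using hB.eventually_le))
  exact le_antisymm (key h' h) (key h h')

theorem IsAlgDim2.unique {U : List Bool →. List Bool} {N : ℕ} [NeZero N]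
    {F : Set (EuclideanSpace ℝ (Fin N))} {D D' : ℝ}
    (h : IsAlgDim2 U F D) (h' : IsAlgDim2 U F D') : D = D' := by
  have hN : (0 : ℝ) < N := Nat.cast_pos.2 (NeZero.pos N)
  have key : ∀ {A B : ℝ}, IsAlgDim2 U F A → IsAlgDim2 U F B → B ≤ A := by
    rintro A B ⟨hA, -⟩ ⟨-, x, hx, c, hB⟩
    exact (div_le_div_iff_of_pos_right hN).1
      ((hA x hx).le_of_eventually (Eventually.of_forall hB))
  exact le_antisymm (key h' h) (key h h')

theorem IsAlgDim3.unique {U : List Bool →. List Bool} {N : ℕ} [NeZero N]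
    {F : Set (EuclideanSpace ℝ (Fin N))} {D D' : ℝ}
    (h : IsAlgDim3 U F D) (h' : IsAlgDim3 U F D') : D = D' := by
  have hN : (0 : ℝ) < N := Nat.cast_pos.2 (NeZero.pos N)
  have key : ∀ {A B : ℝ}, IsAlgDim3 U F A → IsAlgDim3 U F B → B ≤ A := by
    rintro A B ⟨hA, -⟩ ⟨-, x, hx, hB⟩
    exact (div_le_div_iff_of_pos_right hN).1 ((hA x hx).le_of_semiRandom hB)
  exact le_antisymm (key h' h) (key h h')

theorem IsAlgDim4.unique {U : List Bool →. List Bool} {N : ℕ} [NeZero N]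
    {F : Set (EuclideanSpace ℝ (Fin N))} {D D' : ℝ}
    (h : IsAlgDim4 U F D) (h' : IsAlgDim4 U F D') : D = D' := by
  have hN : (0 : ℝ) < N := Nat.cast_pos.2 (NeZero.pos N)
  have key : ∀ {A B : ℝ}, IsAlgDim4 U F A → IsAlgDim4 U F B → B ≤ A := by
    rintro A B ⟨hA, -⟩ ⟨-, hB⟩
    refine (div_le_div_iff_of_pos_right hN).1 (le_of_forall_lt fun e he => ?_)
    obtain ⟨e', hee', he'⟩ := exists_between he
    obtain ⟨x, hx, hxe⟩ := hB e' he'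
    exact hee'.trans_le
      ((hA x hx).le_of_eventually (c := 0) (by simpa using hxe.eventually_le))
  exact le_antisymm (key h' h) (key h h')

/-! ### Computable reals, the r.e. condition, and the upper box-counting dimension -/

/-- The fractional part of `D` has a base-two expansion that is generated by an algorithm. -/
def IsComputableReal (D : ℝ) : Prop :=
  ∃ f : ℕ → Fin 2, Computable f ∧ Real.ofDigits f = Int.fract D

/-- The dyadic rational `0.s` given by a finite binary string `s`. -/
noncomputable def binVal (s : List Bool) : ℝ :=
  ∑ i ∈ Finset.range s.length, if s.getD i false then (1 / 2 : ℝ) ^ (i + 1) else 0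

/-- `I(s) = [0.s, 0.s + 2^{-|s|})`. -/
def dyadicI (s : List Bool) : Set ℝ :=
  Set.Ico (binVal s) (binVal s + (1 / 2 : ℝ) ^ s.length)

/-- `Î(s) = [0.s - 2^{-|s|}, 0.s + 2^{-|s|} + 2^{-|s|}) mod 1`. -/
def dyadicIHat (s : List Bool) : Set ℝ :=
  Int.fract '' Set.Ico (binVal s - (1 / 2 : ℝ) ^ s.length)
    (binVal s + (1 / 2 : ℝ) ^ s.length + (1 / 2 : ℝ) ^ s.length)

/-- `F mod 1`: the set of coordinatewise fractional parts of the points of `F`. -/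
def modOne {N : ℕ} (F : Set (EuclideanSpace ℝ (Fin N))) : Set (Fin N → ℝ) :=
  (fun x i => Int.fract (x i)) '' F

/-- Tuples of strings of equal length whose dyadic cube meets `F mod 1`. -/
def meshSet {N : ℕ} (F : Set (EuclideanSpace ℝ (Fin N))) : Set (Fin N → List Bool) :=
  {s | (∀ i j, (s i).length = (s j).length) ∧
    (Set.univ.pi (fun i => dyadicI (s i)) ∩ modOne F).Nonempty}

/-- Tuples of strings of equal length whose enlarged dyadic cube meets `F mod 1`. -/
def meshSetHat {N : ℕ} (F : Set (EuclideanSpace ℝ (Fin N))) : Set (Fin N → List Bool) :=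
  {s | (∀ i j, (s i).length = (s j).length) ∧
    (Set.univ.pi (fun i => dyadicIHat (s i)) ∩ modOne F).Nonempty}

/-- The r.e. condition on `F`. -/
def RECondition {N : ℕ} (F : Set (EuclideanSpace ℝ (Fin N))) : Prop :=
  ∃ L : Set (Fin N → List Bool), REPred (fun s => s ∈ L) ∧ meshSet F ⊆ L ∧ L ⊆ meshSetHat F

/-- The upper box-counting dimension `limsup_{δ → 0+} log N_δ(F) / (-log δ)`, where `N_δ(F)` is the
least number of closed balls of radius `δ` that cover `F`. -/
noncomputable def upperBoxDim {N : ℕ} (F : Set (EuclideanSpace ℝ (Fin N))) : EReal :=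
  limsup (fun δ : ℝ≥0 =>
    ENNReal.log (Metric.externalCoveringNumber δ F : ℝ≥0∞) / ((-Real.log δ : ℝ) : EReal))
    (𝓝[>] 0)

end AlgDim

/-! Randomness and compressibility are proved separately, one from Hausdorff measure and one from
box counting.

Randomness: the Kraft inequality gives `∑ 2^{-H(s)} ≤ 1`. If `H(x_n) ≤ dn + c` for infinitely many
`n`, then `x` lies in arbitrarily long cylinders of strings `s` with `H(s) ≤ d|s| + c`. Within a
unit cube such a cylinder has diameter `O(2^{-|s|/N})`, so its diameter to the power `dN` is
`O(2^{-H(s)})`, and these covers cost at most tails of a convergent series. Hence the points that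
are not Chaitin `d`-random form an `𝓗^{dN}`-null set (`hausdorffMeasure_infOftenCompressible`), and
a set of positive `𝓗^{dN}` measure contains a Chaitin `d`-random point. For `0 ≤ d < D/N` the
measure of `F` is infinite; for `d = D/N` its positivity is assumed.

Compressibility: let `L` be the set from the r.e. condition. Level `m` of `L` has at most `8^N`
times as many elements as a cover of `F` by balls of radius `2^{-m}` (`ncard_level_le`), hence at
most `2^{m(D+ε)}` up to a constant. To describe `x_n`, give `n` and the index, in an enumeration of
level `n/N + 1` of `L`, of the tuple of digit strings of `x`. A self-delimiting format with overhead
`O(√n)` yields `H(x_n) ≤ θn` eventually for each `θ > D/N` (`eventually_complexity_le`). -/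

namespace AlgDim

/-! ### The Kraft inequality -/

/-- The first words of two factorizations of one string are comparable as prefixes, hence equal, and
can be cancelled. The empty word has to be excluded because it can be inserted anywhere. -/
theorem uniquelyDecodable_of_prefixFree {α : Type*} {S : Set (List α)}
    (h : ∀ p ∈ S, ∀ q ∈ S, p <+: q → p = q) (h0 : [] ∉ S) :
    InformationTheory.UniquelyDecodable S := by
  intro L₁
  induction L₁ with
  | nil =>
    rintro (_ | ⟨w, L⟩) - h₂ he
    · rfl
    · have : w = [] := (List.append_eq_nil_iff.1 he.symm).1
      exact absurd (h₂ w (by simp)) (this ▸ h0)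
  | cons w L ih =>
    rintro (_ | ⟨w', L'⟩) h₁ h₂ he
    · have : w = [] := (List.append_eq_nil_iff.1 he).1
      exact absurd (h₁ w (by simp)) (this ▸ h0)
    · have hw : w ∈ S := h₁ w (by simp)
      have hw' : w' ∈ S := h₂ w' (by simp)
      rw [List.flatten_cons, List.flatten_cons] at he
      have hww : w = w' := by
        rcases List.prefix_or_prefix_of_prefix (List.prefix_append w L.flatten)
          (he ▸ List.prefix_append w' L'.flatten) with hp | hp
        · exact h _ hw _ hw' hp
        · exact (h _ hw' _ hw hp).symm
      subst hww
      rw [ih L' (fun v hv => h₁ v (by simp [hv])) (fun v hv => h₂ v (by simp [hv]))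
        (List.append_cancel_left he)]

theorem tsum_two_inv_pow_length_le {S : Set (List Bool)}
    (h : ∀ p ∈ S, ∀ q ∈ S, p <+: q → p = q) :
    ∑' p : S, (2⁻¹ : ℝ≥0∞) ^ p.1.length ≤ 1 := by
  -- A prefix-free set containing the empty word is `{[]}`; it is not uniquely decodable, but its
  -- sum is 1.
  by_cases h0 : [] ∈ S
  · have hS : S = {[]} := by
      ext p
      exact ⟨fun hp => (h _ h0 _ hp List.nil_prefix).symm, fun hp => hp ▸ h0⟩
    subst hS
    rw [tsum_singleton ([] : List Bool) (fun p : List Bool => (2⁻¹ : ℝ≥0∞) ^ p.length)]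
    simp
  · refine ENNReal.summable.tsum_le_of_sum_le fun T => ?_
    classical
    have hk := InformationTheory.kraft_mcmillan_inequality
      (S := T.map (Function.Embedding.subtype _))
      (uniquelyDecodable_of_prefixFree (S := ((T.map (Function.Embedding.subtype _) :
        Finset (List Bool)) : Set (List Bool)))
        (fun p hp q hq => h p (by simp at hp; exact hp.1) q (by simp at hq; exact hq.1))
        (by simp [h0]))
    simp only [Finset.sum_map, Function.Embedding.coe_subtype, Fintype.card_bool] at hk
    have h2 : ∀ n : ℕ, (2⁻¹ : ℝ≥0∞) ^ n = ENNReal.ofReal ((1 / (2 : ℕ) : ℝ) ^ n) := by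
      intro n
      rw [ENNReal.ofReal_pow (by positivity)]
      congr 1
      rw [one_div, ENNReal.ofReal_inv_of_pos (by norm_num)]
      simp
    simp_rw [h2]
    rw [← ENNReal.ofReal_sum_of_nonneg (fun _ _ => by positivity)]
    simpa using ENNReal.ofReal_le_ofReal hk

/-! ### Complexity as a summable weight on strings -/

theorem exists_length_eq_complexity {C : List Bool →. List Bool} {s : List Bool}
    (h : complexity C s ≠ ⊤) : ∃ p, s ∈ C p ∧ p.length = (complexity C s).toNat := by
  have h1 : complexity C s = ⨅ p : {p // s ∈ C p}, (p.1.length : ℕ∞) := by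
    rw [complexity, iInf_subtype]
  have : Nonempty {p // s ∈ C p} := by
    by_contra hne
    rw [not_nonempty_iff] at hne
    exact h (by rw [h1, iInf_of_empty])
  obtain ⟨p, hp⟩ := ENat.exists_eq_iInf fun p : {p // s ∈ C p} => (p.1.length : ℕ∞)
  exact ⟨p.1, p.2, by rw [h1, ← hp]; rfl⟩

theorem complexity_le {C : List Bool →. List Bool} {s p : List Bool} (h : s ∈ C p) :
    complexity C s ≤ p.length := iInf₂_le p h

/-- Shortest programs of distinct strings are distinct, so the sum is part of the Kraft sum over the
domain. -/
theorem tsum_two_inv_pow_complexity_le {C : List Bool →. List Bool} (hC : IsComputer C) :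
    ∑' s : {s // complexity C s ≠ ⊤}, (2⁻¹ : ℝ≥0∞) ^ (complexity C s.1).toNat ≤ 1 := by
  choose p hp hlen using fun s : {s // complexity C s ≠ ⊤} => exists_length_eq_complexity s.2
  let g : {s // complexity C s ≠ ⊤} → Dom C := fun s => ⟨p s, Part.dom_iff_mem.2 ⟨_, hp s⟩⟩
  have hg : Function.Injective g := fun s t hst => by
    have h1 : p s = p t := congrArg Subtype.val hst
    exact Subtype.ext (Part.mem_unique (hp s) (h1 ▸ hp t))
  calc _ = ∑' s, (2⁻¹ : ℝ≥0∞) ^ (g s).1.length := by simp [g, hlen]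
    _ ≤ ∑' q : Dom C, (2⁻¹ : ℝ≥0∞) ^ q.1.length :=
      ENNReal.tsum_comp_le_tsum_of_injective hg fun q : Dom C => (2⁻¹ : ℝ≥0∞) ^ q.1.length
    _ ≤ 1 := tsum_two_inv_pow_length_le hC.2

/-- `2^{-H_C(s)}`. -/
noncomputable def algWeight (C : List Bool →. List Bool) (s : List Bool) : ℝ≥0∞ :=
  {s | complexity C s ≠ ⊤}.indicator (fun s => (2⁻¹ : ℝ≥0∞) ^ (complexity C s).toNat) s

theorem tsum_algWeight_le {C : List Bool →. List Bool} (hC : IsComputer C) :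
    ∑' s, algWeight C s ≤ 1 := by
  unfold algWeight
  rw [← tsum_subtype]
  exact tsum_two_inv_pow_complexity_le hC

theorem tendsto_tsum_algWeight {C : List Bool →. List Bool} (hC : IsComputer C) :
    Tendsto (fun n : ℕ => ∑' s : {s : List Bool // n ≤ s.length}, algWeight C s.1)
      atTop (𝓝 0) := by
  have h1 : Tendsto (fun n : ℕ => (List.finite_length_lt Bool n).toFinset) atTop atTop := by
    refine tendsto_atTop_finset_of_monotone (fun m n hmn s hs => ?_) fun s => ⟨s.length + 1, ?_⟩
    · simp at hs ⊢
      omega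
    · simp
  have h2 := (ENNReal.tendsto_tsum_compl_atTop_zero
    ((tsum_algWeight_le hC).trans_lt ENNReal.one_lt_top).ne).comp h1
  refine h2.congr fun n => ?_
  simp only [Function.comp_def]
  refine (Equiv.subtypeEquivRight fun s => ?_).tsum_eq
    fun s : {s : List Bool // n ≤ s.length} => algWeight C s.1
  simp

/-! ### Sets of non-random points are null -/

theorem pre_length (α : ℕ → Bool) (n : ℕ) : (pre α n).length = n := by simp [pre]

theorem pre_eq_iff {α β : ℕ → Bool} {n : ℕ} : pre α n = pre β n ↔ ∀ j < n, α j = β j := by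
  simp [pre]

theorem digits_two_eq_of_decide {x y : ℝ} {j : ℕ}
    (h : decide (Real.digits x 2 j = 1) = decide (Real.digits y 2 j = 1)) :
    Real.digits x 2 j = Real.digits y 2 j := by
  rw [decide_eq_decide] at h
  generalize Real.digits x 2 j = a at *
  generalize Real.digits y 2 j = b at *
  revert a b
  decide

theorem fract_mem_Ico (x : ℝ) : Int.fract x ∈ Set.Ico (0 : ℝ) 1 :=
  ⟨Int.fract_nonneg x, Int.fract_lt_one x⟩

/-- The first `n` symbols contain the first `n / N` digits of every coordinate: digit `j` of
coordinate `i` sits at position `j * N + i`. The code forgets integer parts, so these must agree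
separately. -/
theorem abs_sub_le_of_pre_code_eq {N : ℕ} [NeZero N] {x y : EuclideanSpace ℝ (Fin N)} {n : ℕ}
    (hfl : ∀ i, ⌊x i⌋ = ⌊y i⌋) (h : pre (code x) n = pre (code y) n) (i : Fin N) :
    |x i - y i| ≤ ((2 : ℝ) ^ (n / N))⁻¹ := by
  have hN : 0 < N := NeZero.pos N
  have hd : ∀ j < n / N, Real.digits (Int.fract (x i)) 2 j = Real.digits (Int.fract (y i)) 2 j := by
    intro j hj
    have hlt : j * N + i < n := by
      have h1 : (j + 1) * N ≤ n := (Nat.mul_le_mul_right N hj).trans (Nat.div_mul_le_self n N)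
      have := i.2
      rw [add_mul] at h1
      omega
    have h1 := pre_eq_iff.1 h _ hlt
    have h2 : (j * N + i) / N = j := by
      rw [mul_comm, Nat.mul_add_div hN, Nat.div_eq_of_lt i.2, add_zero]
    have h3 : Fin.ofNat N (j * N + i) = i := by
      ext
      simp [Fin.ofNat, Nat.mod_eq_of_lt i.2]
    simp only [code, h2, h3] at h1
    exact digits_two_eq_of_decide h1
  have h4 := Real.abs_ofDigits_sub_ofDigits_le hd
  rw [Real.ofDigits_digits one_lt_two (fract_mem_Ico _),
    Real.ofDigits_digits one_lt_two (fract_mem_Ico _)] at h4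
  have h5 : x i - y i = Int.fract (x i) - Int.fract (y i) := by
    rw [Int.fract, Int.fract, hfl i]
    ring
  rw [h5]
  exact_mod_cast h4

theorem two_pow_div_inv_le {N : ℕ} [NeZero N] (n : ℕ) :
    ((2 : ℝ) ^ (n / N))⁻¹ ≤ 2 * (2 : ℝ) ^ (-(n / N : ℝ)) := by
  have hN : (0 : ℝ) < N := Nat.cast_pos.2 (NeZero.pos N)
  have h1 : (n / N : ℝ) ≤ (n / N : ℕ) + 1 := by
    rw [div_le_iff₀ hN]
    have := Nat.lt_div_mul_add (NeZero.pos N) (a := n)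
    have h : ((n : ℕ) : ℝ) ≤ ((n / N * N + N : ℕ) : ℝ) := by exact_mod_cast this.le
    push_cast at h
    linarith
  calc ((2 : ℝ) ^ (n / N))⁻¹ = (2 : ℝ) ^ (-((n / N : ℕ) : ℝ)) := by
        rw [Real.rpow_neg two_pos.le, Real.rpow_natCast]
    _ ≤ (2 : ℝ) ^ (1 + -(n / N : ℝ)) :=
        Real.rpow_le_rpow_of_exponent_le one_le_two (by linarith)
    _ = _ := by rw [Real.rpow_add two_pos, Real.rpow_one]

theorem ediam_cylinder_le {N : ℕ} [NeZero N] (v : Fin N → ℤ) (s : List Bool) :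
    Metric.ediam {x : EuclideanSpace ℝ (Fin N) | (∀ i, ⌊x i⌋ = v i) ∧ pre (code x) s.length = s} ≤
      ENNReal.ofReal (2 * N * (2 : ℝ) ^ (-(s.length / N : ℝ))) := by
  refine Metric.ediam_le fun x hx y hy => ?_
  rw [edist_dist]
  refine ENNReal.ofReal_le_ofReal ?_
  have h1 : ∀ i, |x i - y i| ≤ 2 * (2 : ℝ) ^ (-(s.length / N : ℝ)) := fun i =>
    (abs_sub_le_of_pre_code_eq (fun i => (hx.1 i).trans (hy.1 i).symm) (hx.2.trans hy.2.symm)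
      i).trans (two_pow_div_inv_le _)
  calc dist x y ≤ ∑ i, |x i - y i| := by
        rw [dist_eq_norm, EuclideanSpace.norm_eq]
        refine Real.sqrt_le_left (by positivity) |>.2 ?_
        exact Finset.sum_sq_le_sq_sum_of_nonneg fun i _ => abs_nonneg _
    _ ≤ ∑ i : Fin N, 2 * (2 : ℝ) ^ (-(s.length / N : ℝ)) := Finset.sum_le_sum fun i _ => h1 i
    _ = _ := by
        simp
        ring

/-- The points `x` with `H(x_n) ≤ d n + c` for infinitely many `n`. -/
def infOftenCompressible (U : List Bool →. List Bool) (N : ℕ) [NeZero N] (d c : ℝ) :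
    Set (EuclideanSpace ℝ (Fin N)) :=
  {x | ∃ᶠ n : ℕ in atTop, complexityE U (pre (code x) n) ≤ ((d * n + c : ℝ) : EReal)}

theorem complexityE_eq_coe_toNat {C : List Bool →. List Bool} {s : List Bool}
    (h : complexity C s ≠ ⊤) : complexityE C s = (((complexity C s).toNat : ℝ) : EReal) := by
  obtain ⟨n, hn⟩ := ENat.ne_top_iff_exists.1 h
  rw [complexityE, ← hn]
  simp only [ENat.toENNReal_coe, ENat.toNat_natCast]
  rfl

theorem complexity_ne_top_of_le {C : List Bool →. List Bool} {s : List Bool} {r : ℝ}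
    (h : complexityE C s ≤ (r : EReal)) : complexity C s ≠ ⊤ := by
  intro ht
  rw [complexityE, ht] at h
  simp at h

/-- The exponent `d * N` turns the diameter scale `2^{-|s|/N}` into `2^{-d|s|}`, which `hs` bounds
by `2^c · 2^{-H(s)}`. -/
theorem ediam_rpow_le {U : List Bool →. List Bool} {N : ℕ} [NeZero N] {d c : ℝ} (hd : 0 ≤ d)
    (v : Fin N → ℤ) {s : List Bool} (hs : complexityE U s ≤ ((d * s.length + c : ℝ) : EReal)) :
    Metric.ediam {x : EuclideanSpace ℝ (Fin N) |
        (∀ i, ⌊x i⌋ = v i) ∧ pre (code x) s.length = s} ^ (d * N) ≤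
      ENNReal.ofReal ((2 * N) ^ (d * N) * 2 ^ c) * algWeight U s := by
  have hN : (0 : ℝ) < N := Nat.cast_pos.2 (NeZero.pos N)
  have hne := complexity_ne_top_of_le hs
  rw [complexityE_eq_coe_toNat hne, EReal.coe_le_coe_iff] at hs
  have hw : algWeight U s = ENNReal.ofReal ((2 : ℝ) ^ (-((complexity U s).toNat : ℝ))) := by
    rw [algWeight, Set.indicator_of_mem hne, Real.rpow_neg two_pos.le, Real.rpow_natCast,
      ← inv_pow, ENNReal.ofReal_pow (by positivity), ENNReal.ofReal_inv_of_pos two_pos]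
    simp
  rw [hw, ← ENNReal.ofReal_mul (by positivity)]
  refine (ENNReal.rpow_le_rpow (ediam_cylinder_le v s) (by positivity)).trans ?_
  rw [ENNReal.ofReal_rpow_of_nonneg (by positivity) (by positivity)]
  refine ENNReal.ofReal_le_ofReal ?_
  rw [Real.mul_rpow (by positivity) (by positivity), mul_assoc, ← Real.rpow_add two_pos,
    ← Real.rpow_mul two_pos.le]
  gcongr
  · norm_num
  · have : -(s.length / N : ℝ) * (d * N) = -(d * s.length) := by field_simp
    linarith

theorem hausdorffMeasure_infOftenCompressible_inter {U : List Bool →. List Bool}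
    (hU : IsComputer U) {N : ℕ} [NeZero N] {d : ℝ} (hd : 0 ≤ d) (c : ℝ) (v : Fin N → ℤ) :
    μH[d * N] (infOftenCompressible U N d c ∩ {x | ∀ i, ⌊x i⌋ = v i}) = 0 := by
  have hN : (0 : ℝ) < N := Nat.cast_pos.2 (NeZero.pos N)
  let ι : ℕ → Type := fun n =>
    {s : List Bool // n ≤ s.length ∧ complexityE U s ≤ ((d * s.length + c : ℝ) : EReal)}
  let t : ∀ n, ι n → Set (EuclideanSpace ℝ (Fin N)) := fun n s =>
    {x | (∀ i, ⌊x i⌋ = v i) ∧ pre (code x) s.1.length = s.1}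
  let r : ℕ → ℝ≥0∞ := fun n => ENNReal.ofReal (2 * N * (2 : ℝ) ^ (-(n / N : ℝ)))
  have hr : Tendsto r atTop (𝓝 0) := by
    rw [← ENNReal.ofReal_zero, ← mul_zero (2 * N : ℝ)]
    refine ENNReal.tendsto_ofReal (Tendsto.const_mul _ ?_)
    have := (tendsto_rpow_atTop_of_base_lt_one (1 / 2 : ℝ) (by norm_num) (by norm_num)).comp
      (tendsto_natCast_atTop_atTop.atTop_div_const hN)
    refine this.congr fun n => ?_
    simp only [Function.comp_def]
    rw [one_div, Real.inv_rpow two_pos.le, Real.rpow_neg two_pos.le]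
  have h := Measure.hausdorffMeasure_le_liminf_tsum (d * N)
    (infOftenCompressible U N d c ∩ {x | ∀ i, ⌊x i⌋ = v i}) r hr t
    (Eventually.of_forall fun n s => (ediam_cylinder_le v s.1).trans
      (ENNReal.ofReal_le_ofReal (by
        gcongr
        · norm_num
        · exact_mod_cast s.2.1)))
    (Eventually.of_forall fun n x hx => by
      obtain ⟨k, hk, hc⟩ := frequently_atTop.1 hx.1 n
      exact Set.mem_iUnion.2 ⟨⟨pre (code x) k, by simpa [pre_length] using ⟨hk, hc⟩⟩,
        hx.2, by simp only [pre_length]⟩)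
  have hlim : Tendsto (fun n : ℕ => ENNReal.ofReal ((2 * N) ^ (d * N) * 2 ^ c) *
      ∑' s : {s : List Bool // n ≤ s.length}, algWeight U s.1) atTop (𝓝 0) := by
    have := ENNReal.Tendsto.const_mul (tendsto_tsum_algWeight hU)
      (Or.inr (ENNReal.ofReal_ne_top (r := (2 * N) ^ (d * N) * 2 ^ c)))
    rwa [mul_zero] at this
  refine le_antisymm (h.trans ?_) zero_le
  rw [← hlim.liminf_eq]
  refine liminf_le_liminf (Eventually.of_forall fun n => ?_)
  rw [← ENNReal.tsum_mul_left]
  let g : ι n → {s : List Bool // n ≤ s.length} := fun s => ⟨s.1, s.2.1⟩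
  refine le_trans (ENNReal.tsum_le_tsum fun s : ι n => ediam_rpow_le hd v s.2.2) ?_
  exact ENNReal.tsum_comp_le_tsum_of_injective (f := g)
    (fun s s' hs => Subtype.ext (congrArg (fun z => z.1) hs))
    fun s => ENNReal.ofReal ((2 * N) ^ (d * N) * 2 ^ c) * algWeight U s.1

theorem hausdorffMeasure_infOftenCompressible {U : List Bool →. List Bool}
    (hU : IsComputer U) {N : ℕ} [NeZero N] {d : ℝ} (hd : 0 ≤ d) (c : ℝ) :
    μH[d * N] (infOftenCompressible U N d c) = 0 := by
  have : infOftenCompressible U N d c =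
      ⋃ v : Fin N → ℤ, infOftenCompressible U N d c ∩ {x | ∀ i, ⌊x i⌋ = v i} := by
    rw [← Set.inter_iUnion, eq_comm, Set.inter_eq_left]
    exact fun x _ => Set.mem_iUnion.2 ⟨fun i => ⌊x i⌋, fun i => rfl⟩
  rw [this]
  exact measure_iUnion_null fun v => hausdorffMeasure_infOftenCompressible_inter hU hd c v

/-- Taking `c` a natural number makes the exceptional set a countable union. -/
theorem exists_mem_infOftenCompressible {U : List Bool →. List Bool} {N : ℕ} [NeZero N] {d : ℝ}
    {x : EuclideanSpace ℝ (Fin N)} (h : ¬ IsChaitinRandom U d (code x)) :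
    ∃ c : ℕ, x ∈ infOftenCompressible U N d c := by
  rw [IsChaitinRandom, EReal.tendsto_nhds_top_iff_real] at h
  push Not at h
  obtain ⟨r, hr⟩ := h
  obtain ⟨c, hc⟩ := exists_nat_ge r
  refine ⟨c, hr.mono fun n hn => ?_⟩
  have h1 := EReal.sub_le_iff_le_add (Or.inl (EReal.coe_ne_bot _)) (Or.inl (EReal.coe_ne_top _))
    |>.1 hn
  refine h1.trans ?_
  rw [← EReal.coe_add, EReal.coe_le_coe_iff]
  linarith

/-- A set of positive `dN`-dimensional Hausdorff measure has a Chaitin `d`-random point. -/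
theorem exists_isChaitinRandom {U : List Bool →. List Bool} (hU : IsComputer U) {N : ℕ} [NeZero N]
    {F : Set (EuclideanSpace ℝ (Fin N))} {d : ℝ} (hd : 0 ≤ d) (hF : 0 < μH[d * N] F) :
    ∃ x ∈ F, IsChaitinRandom U d (code x) := by
  by_contra! hne
  refine hF.ne' (measure_mono_null (t := ⋃ c : ℕ, infOftenCompressible U N d c) (fun x hx => ?_)
    (measure_iUnion_null fun c : ℕ => hausdorffMeasure_infOftenCompressible hU hd c))
  exact Set.mem_iUnion.2 (exists_mem_infOftenCompressible (hne x hx))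

theorem isChaitinRandom_of_neg {U : List Bool →. List Bool} {d : ℝ} (hd : d < 0) (α : ℕ → Bool) :
    IsChaitinRandom U d α := by
  rw [IsChaitinRandom, EReal.tendsto_nhds_top_iff_real]
  intro r
  have h1 : Tendsto (fun n : ℕ => -d * (n : ℝ)) atTop atTop :=
    tendsto_natCast_atTop_atTop.const_mul_atTop (neg_pos.2 hd)
  filter_upwards [h1.eventually_gt_atTop r] with n hn
  have h2 : (0 : EReal) ≤ complexityE U (pre α n) := EReal.coe_ennreal_nonneg _
  calc (r : EReal) < ((-d * n : ℝ) : EReal) := EReal.coe_lt_coe_iff.2 hn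
    _ = 0 - ((d * n : ℝ) : EReal) := by simp
    _ ≤ _ := EReal.sub_le_sub h2 le_rfl

theorem IsChaitinRandom.isSemiRandom {U : List Bool →. List Bool} {d : ℝ} {α : ℕ → Bool}
    (h : IsChaitinRandom U d α) : IsSemiRandom U d α := by
  refine le_liminf_of_le (by isBoundedDefault) ?_
  filter_upwards [h.eventually_le, eventually_gt_atTop 0] with n hn hpos
  have h3 : (0 : EReal) < ((n : ℝ) : EReal) := EReal.coe_pos.2 (Nat.cast_pos.2 hpos)
  rw [EReal.le_div_iff_mul_le h3 (EReal.coe_ne_top _)]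
  exact_mod_cast hn

theorem IsChaitinRandom.isWeaklyChaitinRandom {U : List Bool →. List Bool} {d : ℝ} {α : ℕ → Bool}
    (hd : 0 ≤ d) (h : IsChaitinRandom U d α) : IsWeaklyChaitinRandom U d α := by
  obtain ⟨n₀, hn₀⟩ := eventually_atTop.1 h.eventually_le
  -- For `n ≤ n₀` this constant makes the lower bound nonpositive.
  refine ⟨d * n₀, fun n => ?_⟩
  rcases le_total n₀ n with hn | hn
  · refine le_trans (EReal.coe_le_coe_iff.2 ?_) (hn₀ n hn)
    have : 0 ≤ d * n₀ := by positivity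
    linarith
  · have h2 : (0 : EReal) ≤ complexityE U (pre α n) := EReal.coe_ennreal_nonneg _
    refine le_trans ?_ h2
    rw [← EReal.coe_zero, EReal.coe_le_coe_iff]
    have : (n : ℝ) ≤ n₀ := by exact_mod_cast hn
    nlinarith

/-! ### Enumerating a recursively enumerable set level by level -/

open Nat.Partrec (Code) in
/-- An r.e. set is enumerated without repetitions by a computable function. -/
theorem exists_computable_stage {α : Type*} [Primcodable α] {L : Set α}
    (hL : REPred (fun s => s ∈ L)) :
    ∃ stage : ℕ → Option α, Computable stage ∧ (∀ s ∈ L, ∃ t, stage t = some s) ∧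
      (∀ t s, stage t = some s → s ∈ L) ∧
      ∀ t t' s, stage t = some s → stage t' = some s → t = t' := by
  obtain ⟨c, hc⟩ := Code.exists_code.1 hL
  have hdom : ∀ s : α, (∃ k, (c.evaln k (Encodable.encode s)).isSome) ↔ s ∈ L := by
    intro s
    have h1 : (c.eval (Encodable.encode s)).Dom ↔ s ∈ L := by
      rw [hc]
      simp [Part.assert]
    rw [← h1, Part.dom_iff_mem]
    constructor
    · rintro ⟨k, hk⟩
      obtain ⟨x, hx⟩ := Option.isSome_iff_exists.1 hk
      exact ⟨x, Code.evaln_sound hx⟩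
    · rintro ⟨x, hx⟩
      obtain ⟨k, hk⟩ := Code.evaln_complete.1 hx
      exact ⟨k, Option.isSome_iff_exists.2 ⟨x, hk⟩⟩
  have hmono : ∀ {i k l}, k ≤ l → (c.evaln k i).isSome → (c.evaln l i).isSome := by
    intro i k l hkl hk
    obtain ⟨x, hx⟩ := Option.isSome_iff_exists.1 hk
    exact Option.isSome_iff_exists.2 ⟨x, Code.evaln_mono hkl hx⟩
  -- Stage `t = (i, k)` outputs the element with code `i` exactly when the bounded evaluation
  -- succeeds with bound `k + 1` but not with `k`. By monotonicity this happens for only one `k`,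
  -- which excludes repetitions.
  refine ⟨fun t => bif (c.evaln (t.unpair.2 + 1) t.unpair.1).isSome &&
    !(c.evaln t.unpair.2 t.unpair.1).isSome then Encodable.decode₂ α t.unpair.1 else none,
    ?_, ?_, ?_, ?_⟩
  · have h1 : Primrec fun t : ℕ => t.unpair.1 := Primrec.fst.comp Primrec.unpair
    have h2 : Primrec fun t : ℕ => t.unpair.2 := Primrec.snd.comp Primrec.unpair
    have hev : ∀ {g : ℕ → ℕ}, Primrec g → Primrec fun t : ℕ => (c.evaln (g t) t.unpair.1).isSome :=
      fun hg => Primrec.option_isSome.comp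
        (Code.primrec_evaln.comp ((hg.pair (Primrec.const c)).pair h1))
    exact (Primrec.cond (Primrec.and.comp (hev (Primrec.succ.comp h2))
      (Primrec.not.comp (hev h2))) (Primrec.decode₂.comp h1) (Primrec.const none)).to_comp
  · intro s hs
    have hex := (hdom s).2 hs
    classical
    have h0 : Nat.find hex ≠ 0 := by
      intro h0
      have := Nat.find_spec hex
      rw [h0] at this
      simp [Code.evaln] at this
    obtain ⟨k, hk⟩ := Nat.exists_eq_succ_of_ne_zero h0
    have h1 : (c.evaln (k + 1) (Encodable.encode s)).isSome := by
      have := Nat.find_spec hex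
      rwa [hk] at this
    have h2 : ¬ (c.evaln k (Encodable.encode s)).isSome := Nat.find_min hex (by omega)
    refine ⟨Nat.pair (Encodable.encode s) k, ?_⟩
    simp only [Nat.unpair_pair, h1, h2]
    simp
  · intro t s h
    simp only [Bool.cond_eq_ite] at h
    split_ifs at h with hb
    have h1 := Encodable.mem_decode₂.1 (show s ∈ Encodable.decode₂ α t.unpair.1 from h)
    rw [Bool.and_eq_true] at hb
    exact (hdom s).1 ⟨_, h1 ▸ hb.1⟩
  · have key : ∀ (t : ℕ) (s : α), (bif (c.evaln (t.unpair.2 + 1) t.unpair.1).isSome &&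
        !(c.evaln t.unpair.2 t.unpair.1).isSome then Encodable.decode₂ α t.unpair.1 else none)
        = some s → t.unpair.1 = Encodable.encode s ∧
        (c.evaln (t.unpair.2 + 1) (Encodable.encode s)).isSome ∧
        ¬ (c.evaln t.unpair.2 (Encodable.encode s)).isSome := by
      intro t s h
      rw [Bool.cond_eq_ite] at h
      split_ifs at h with hb
      have h1 := Encodable.mem_decode₂.1 (show s ∈ Encodable.decode₂ α t.unpair.1 from h)
      rw [← h1] at hb
      simp only [Bool.and_eq_true, Bool.not_eq_true'] at hb
      exact ⟨h1.symm, hb.1, by simp [hb.2]⟩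
    intro t t' s h h'
    obtain ⟨h1, h2, h3⟩ := key t s h
    obtain ⟨h1', h2', h3'⟩ := key t' s h'
    have h4 : t.unpair.2 = t'.unpair.2 := by
      by_contra hne
      rcases Nat.lt_or_gt_of_ne hne with hlt | hlt
      · exact h3' (hmono hlt h2)
      · exact h3 (hmono hlt h2')
    rw [← Nat.pair_unpair t, ← Nat.pair_unpair t', h1, h1', h4]

theorem Computable.nat_count {α : Type*} [Primcodable α] {p : α → ℕ → Prop}
    [∀ a, DecidablePred (p a)] (hp : Computable₂ fun a n => decide (p a n)) :
    Computable₂ fun a n => Nat.count (p a) n := by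
  have h : Computable₂ fun (x : α × ℕ) (y : ℕ × ℕ) => y.2 + (decide (p x.1 y.1)).toNat :=
    Primrec.nat_add.to_comp.comp (Computable.snd.comp Computable.snd)
      ((Primrec.dom_bool Bool.toNat).to_comp.comp
        (hp.comp (Computable.fst.comp Computable.fst) (Computable.fst.comp Computable.snd)))
  refine (Computable.nat_rec Computable.snd (Computable.const 0) h).of_eq fun x => ?_
  obtain ⟨a, n⟩ := x
  induction n with
  | zero => simp
  | succ n ih =>
    simp only at ih ⊢
    rw [ih, Nat.count_succ]
    by_cases hpn : p a n <;> simp [hpn]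

/-- If the levels of an r.e. set are finite, then the elements of level `m` are obtained from `m`
and a number that is less than the size of that level. -/
theorem exists_partrec_enumeration {α : Type*} [Primcodable α] {L : Set α}
    (hL : REPred (fun s => s ∈ L)) {lev : α → ℕ} (hlev : Computable lev) :
    ∃ e : ℕ → ℕ →. α, Partrec₂ e ∧ ∀ m, {s ∈ L | lev s = m}.Finite → ∀ s ∈ L, lev s = m →
      ∃ k < {s ∈ L | lev s = m}.ncard, s ∈ e m k := by
  obtain ⟨stage, hstage, hsurj, hmem, hinj⟩ := exists_computable_stage hL
  let P : ℕ → ℕ → Prop := fun m t => (stage t).map lev = some m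
  have hP : Computable₂ fun m t => decide (P m t) :=
    (Primrec.eq (α := Option ℕ)).decide.to_comp.comp
      (Computable.option_map (hstage.comp Computable.snd) (hlev.comp Computable.snd).to₂)
      (Computable.option_some.comp Computable.fst)
  have hcount := Computable.nat_count hP
  -- Search for the stage that yields an element of level `m` and is preceded by exactly `k` such
  -- stages.
  refine ⟨fun m k => Nat.rfindOpt fun t =>
    bif decide (P m t) && decide (Nat.count (P m) t = k) then stage t else none, ?_, ?_⟩
  · refine Partrec.rfindOpt (Computable.cond ?_ (hstage.comp Computable.snd) (Computable.const none))
    have hm : Computable fun x : (ℕ × ℕ) × ℕ => x.1.1 := Computable.fst.comp Computable.fst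
    exact Primrec.and.to_comp.comp (hP.comp hm Computable.snd)
      ((Primrec.eq (α := ℕ)).decide.to_comp.comp (hcount.comp hm Computable.snd)
        (Computable.snd.comp Computable.fst))
  · intro m hfin s hs hsm
    obtain ⟨t, ht⟩ := hsurj s hs
    have hPt : P m t := by simp [P, ht, hsm]
    -- Stages of level `m` inject into elements of level `m` since nothing is enumerated twice.
    have hcard : ({t | P m t}).Finite ∧ ({t | P m t}).ncard ≤ {s ∈ L | lev s = m}.ncard := by
      have h1 : ∀ t ∈ {t | P m t}, ∃ s, stage t = some s ∧ lev s = m := by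
        intro t (ht : (stage t).map lev = some m)
        simpa using ht
      have : Nonempty α := ⟨s⟩
      choose! g hg using h1
      have hmaps : Set.MapsTo g ({t | P m t}) {s ∈ L | lev s = m} :=
        fun t ht => ⟨hmem t _ (hg t ht).1, (hg t ht).2⟩
      have hgi : Set.InjOn g ({t | P m t}) := fun t ht t' ht' h =>
        hinj t t' _ (hg t ht).1 (h ▸ (hg t' ht').1)
      exact ⟨Set.Finite.of_injOn hmaps hgi hfin, Set.ncard_le_ncard_of_injOn g hmaps hgi hfin⟩
    refine ⟨Nat.count (P m) t, ?_, ?_⟩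
    · refine lt_of_lt_of_le ?_ hcard.2
      rw [Set.ncard_eq_toFinset_card _ hcard.1]
      exact Nat.count_lt_card hcard.1 hPt
    · have hd : (Nat.rfindOpt fun t' => bif decide (P m t') &&
          decide (Nat.count (P m) t' = Nat.count (P m) t) then stage t' else none).Dom :=
        Nat.rfindOpt_dom.2 ⟨t, s, by simp [hPt, ht]⟩
      obtain ⟨s', hs'⟩ := Part.dom_iff_mem.1 hd
      obtain ⟨t', ht'⟩ := Nat.rfindOpt_spec hs'
      rw [Option.mem_def, Bool.cond_eq_ite] at ht'
      split_ifs at ht' with hb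
      simp only [Bool.and_eq_true, decide_eq_true_eq] at hb
      have := Nat.count_injective hb.1 hPt hb.2
      subst this
      rw [ht] at ht'
      cases ht'
      exact hs'

/-! ### A prefix-free machine -/

/-- The number with the given binary digits, the most significant one first. -/
def binNat (l : List Bool) : ℕ := l.foldl (fun v b => 2 * v + b.toNat) 0

theorem binNat_append (u w : List Bool) : binNat (u ++ w) = binNat u * 2 ^ w.length + binNat w := by
  induction w using List.reverseRecOn with
  | nil => simp [binNat]
  | append_singleton w b ih =>
    have h : ∀ (l : List Bool), binNat (l ++ [b]) = 2 * binNat l + b.toNat := by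
      intro l
      simp [binNat]
    rw [← List.append_assoc, h, h, ih, List.length_append, List.length_singleton, pow_succ]
    ring

theorem binNat_lt (l : List Bool) : binNat l < 2 ^ l.length := by
  induction l using List.reverseRecOn with
  | nil => simp [binNat]
  | append_singleton w b ih =>
    rw [binNat_append]
    have : binNat [b] ≤ 1 := by cases b <;> simp [binNat]
    simp only [List.length_append, List.length_singleton, pow_succ]
    omega

theorem exists_binNat_eq {l v : ℕ} (h : v < 2 ^ l) : ∃ w : List Bool, w.length = l ∧ binNat w = v := by
  induction l generalizing v with
  | zero => exact ⟨[], rfl, by simp at h; simp [binNat, h]⟩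
  | succ l ih =>
    obtain ⟨w, hw, hv⟩ := ih (v := v / 2) (by rw [pow_succ] at h; omega)
    refine ⟨w ++ [decide (v % 2 = 1)], by simp [hw], ?_⟩
    rw [binNat_append, hv]
    have : v % 2 < 2 := Nat.mod_lt _ two_pos
    interval_cases hm : v % 2 <;> simp [binNat] <;> omega

theorem binNat_injOn {u w : List Bool} (hl : u.length = w.length) (h : binNat u = binNat w) :
    u = w := by
  induction u generalizing w with
  | nil => exact (List.eq_nil_of_length_eq_zero hl.symm).symm
  | cons b u ih =>
    obtain _ | ⟨b', w⟩ := w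
    · simp at hl
    have hl' : u.length = w.length := by simpa using hl
    rw [← List.singleton_append, ← List.singleton_append (l := w), binNat_append, binNat_append,
      hl'] at h
    have h1 := binNat_lt u
    have h2 := binNat_lt w
    rw [hl'] at h1
    cases b <;> cases b' <;> simp [binNat] at h h1 h2 ⊢
    · exact ih hl' h
    · omega
    · omega
    · exact ih hl' h

theorem primrec_binNat : Primrec binNat := by
  have h : Primrec₂ fun (_ : List Bool) (x : ℕ × Bool) => 2 * x.1 + x.2.toNat :=
    Primrec.nat_add.comp (Primrec.nat_mul.comp (Primrec.const 2) (Primrec.fst.comp Primrec.snd))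
      ((Primrec.dom_bool Bool.toNat).comp (Primrec.snd.comp Primrec.snd))
  exact Primrec.list_foldl Primrec.id (Primrec.const 0) h

/-- The number of ones at the beginning of a string. -/
def leadingOnes (p : List Bool) : ℕ := p.findIdx (!·)

/-- Reads a program `1ᵃ 0 w` with `|w| = a²`, and applies `g` to `a` and to the number `w`. -/
def headerMachine (g : ℕ → ℕ →. List Bool) : List Bool →. List Bool := fun p =>
  -- A string of ones only fails this test, its length being `leadingOnes p`. In a valid program the
  -- header contributes a multiple of `2^{a²}` to `binNat p`, which the remainder removes.
  bif decide (p.length = leadingOnes p * leadingOnes p + leadingOnes p + 1) then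
    g (leadingOnes p) (binNat p % 2 ^ (leadingOnes p * leadingOnes p))
  else Part.none

/-- A valid program already contains the zero ending its header, so every extension has the same
`leadingOnes`, which fixes the valid length. -/
theorem isComputer_headerMachine {g : ℕ → ℕ →. List Bool} (hg : Partrec₂ g) :
    IsComputer (headerMachine g) := by
  have hlen : ∀ p ∈ Dom (headerMachine g),
      p.length = leadingOnes p * leadingOnes p + leadingOnes p + 1 := by
    intro p hp
    by_contra hne
    simp [Dom, headerMachine, hne] at hp
  constructor
  · have h1 : Primrec leadingOnes :=
      Primrec.list_findIdx Primrec.id (Primrec.not.comp Primrec.snd).to₂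
    have h2 : Primrec fun p => leadingOnes p * leadingOnes p := Primrec.nat_mul.comp h1 h1
    have hpow : Primrec₂ ((· ^ ·) : ℕ → ℕ → ℕ) := Primrec₂.unpaired'.1 Nat.Primrec.pow
    refine Partrec.cond ?_ (hg.comp h1.to_comp (Primrec.nat_mod.comp primrec_binNat
      (hpow.comp (Primrec.const 2) h2)).to_comp) Partrec.none
    exact ((Primrec.eq (α := ℕ)).decide.comp Primrec.list_length
      (Primrec.succ.comp (Primrec.nat_add.comp h2 h1))).to_comp
  · rintro p hp q hq ⟨r, rfl⟩
    have h1 : leadingOnes (p ++ r) = leadingOnes p := by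
      rw [leadingOnes, List.findIdx_append, if_pos, leadingOnes]
      have := hlen p hp
      rw [leadingOnes] at this
      nlinarith
    have h2 := hlen _ hq
    rw [h1, ← hlen p hp, List.length_append] at h2
    simp [List.eq_nil_of_length_eq_zero (show r.length = 0 by omega)]

theorem exists_headerMachine_eq (g : ℕ → ℕ →. List Bool) {a v : ℕ} (h : v < 2 ^ (a * a)) :
    ∃ p, p.length = a * a + a + 1 ∧ headerMachine g p = g a v := by
  obtain ⟨w, hw, rfl⟩ := exists_binNat_eq h
  have h1 : leadingOnes (List.replicate a true ++ ([false] ++ w)) = a := by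
    rw [leadingOnes, List.findIdx_append]
    have h2 : ¬ List.findIdx (fun x => !x) (List.replicate a true) < a := by
      intro hlt
      have := List.findIdx_getElem (p := fun x => !x) (xs := List.replicate a true)
        (w := by simpa using hlt)
      simp at this
    simp [h2, List.findIdx_cons]
  have hl : (List.replicate a true ++ ([false] ++ w)).length = a * a + a + 1 := by
    simp [hw]
    ring
  refine ⟨_, hl, ?_⟩
  rw [headerMachine, h1, hl, ← List.append_assoc, binNat_append, hw, Nat.mul_add_mod_of_lt h,
    ← hw]
  simp [hw]

/-- The first `n` symbols of the sequence obtained by interleaving `N` strings. -/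
def interleave {N : ℕ} [NeZero N] (n : ℕ) (s : Fin N → List Bool) : List Bool :=
  (List.range n).map fun j => (s (Fin.ofNat N j)).getD (j / N) false

theorem computable_interleave (N : ℕ) [NeZero N] :
    Computable₂ (interleave : ℕ → (Fin N → List Bool) → List Bool) := by
  have h1 : Primrec fun j : ℕ => Fin.ofNat N j :=
    Primrec.fin_val_iff.1 ((Primrec.nat_mod.comp Primrec.id (Primrec.const N)).of_eq
      fun j => by simp [Fin.ofNat])
  have h2 : Primrec₂ fun (x : ℕ × (Fin N → List Bool)) (j : ℕ) =>
      (x.2 (Fin.ofNat N j)).getD (j / N) false :=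
    (Primrec.list_getD false).comp
      (Primrec.fin_app.comp (Primrec.snd.comp Primrec.fst) (h1.comp Primrec.snd))
      (Primrec.nat_div.comp Primrec.snd (Primrec.const N))
  exact (Primrec.list_map (Primrec.list_range.comp Primrec.fst) h2).to_comp

/-- The elements of `L` whose first string has length `m`. -/
def level {N : ℕ} [NeZero N] (L : Set (Fin N → List Bool)) (m : ℕ) : Set (Fin N → List Bool) :=
  {s ∈ L | (s 0).length = m}

/-- Prefixes that are interleavings of elements of an r.e. set have a complexity governed by the
sizes of the levels of the set. -/
theorem exists_complexity_interleave_le {U : List Bool →. List Bool} (hU : IsOptimalComputer U)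
    {N : ℕ} [NeZero N] {L : Set (Fin N → List Bool)} (hL : REPred (fun s => s ∈ L))
    (hfin : ∀ m, (level L m).Finite) :
    ∃ c : ℕ, ∀ n a : ℕ, n < 2 ^ a → (level L (n / N + 1)).ncard * 2 ^ a ≤ 2 ^ (a * a) →
      ∀ s ∈ level L (n / N + 1), complexity U (interleave n s) ≤ (a * a + a + 1 + c : ℕ) := by
  obtain ⟨e, he, hek⟩ := exists_partrec_enumeration hL
    (lev := fun s : Fin N → List Bool => (s 0).length)
    (Primrec.list_length.comp (Primrec.fin_app.comp Primrec.id (Primrec.const 0))).to_comp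
  -- The payload is `v = k * 2^a + n`: its low `a` bits hold `n`, the rest the index `k` in level `n
  -- / N + 1`.
  let g : ℕ → ℕ →. List Bool := fun a v =>
    (e (v % 2 ^ a / N + 1) (v / 2 ^ a)).map (interleave (v % 2 ^ a))
  have hg : Partrec₂ g := by
    have hpow : Primrec₂ ((· ^ ·) : ℕ → ℕ → ℕ) := Primrec₂.unpaired'.1 Nat.Primrec.pow
    have h2 : Primrec fun x : ℕ × ℕ => 2 ^ x.1 := hpow.comp (Primrec.const 2) Primrec.fst
    have hn : Primrec fun x : ℕ × ℕ => x.2 % 2 ^ x.1 := Primrec.nat_mod.comp Primrec.snd h2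
    refine Partrec.map (he.comp (Primrec.succ.comp
      (Primrec.nat_div.comp hn (Primrec.const N))).to_comp
      (Primrec.nat_div.comp Primrec.snd h2).to_comp) ?_
    exact (computable_interleave N).comp (hn.to_comp.comp Computable.fst) Computable.snd
  obtain ⟨c, hc⟩ := hU.2 _ (isComputer_headerMachine hg)
  refine ⟨c, fun n a hn ha s hs => ?_⟩
  obtain ⟨k, hk, hsk⟩ := hek (n / N + 1) (hfin _) s hs.1 hs.2
  have hv : k * 2 ^ a + n < 2 ^ (a * a) := by
    have h1 : (k + 1) * 2 ^ a ≤ (level L (n / N + 1)).ncard * 2 ^ a :=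
      Nat.mul_le_mul_right _ hk
    rw [add_mul] at h1
    omega
  obtain ⟨p, hp, hpg⟩ := exists_headerMachine_eq g hv
  have hmem : interleave n s ∈ headerMachine g p := by
    rw [hpg]
    have h1 : (k * 2 ^ a + n) % 2 ^ a = n := Nat.mul_add_mod_of_lt hn
    have h2 : (k * 2 ^ a + n) / 2 ^ a = k := by
      rw [mul_comm, Nat.mul_add_div (by positivity), Nat.div_eq_of_lt hn, add_zero]
    simp only [g, h1, h2]
    exact Part.mem_map _ hsk
  obtain ⟨q, hq, hlen⟩ := hc p _ hmem
  refine (complexity_le hq).trans ?_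
  rw [hp] at hlen
  exact_mod_cast hlen

/-! ### Dyadic cubes that meet a set -/

theorem binVal_append_singleton (w : List Bool) (b : Bool) :
    binVal (w ++ [b]) = binVal w + if b then (1 / 2 : ℝ) ^ (w.length + 1) else 0 := by
  rw [binVal, List.length_append, List.length_singleton, Finset.sum_range_succ, binVal]
  congr 1
  · refine Finset.sum_congr rfl fun i hi => ?_
    rw [List.getD_append _ _ _ _ (Finset.mem_range.1 hi)]
  · simp

theorem binVal_mul_two_pow (s : List Bool) : binVal s * 2 ^ s.length = binNat s := by
  induction s using List.reverseRecOn with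
  | nil => simp [binVal, binNat]
  | append_singleton w b ih =>
    rw [binVal_append_singleton, binNat_append, List.length_append, List.length_singleton, pow_succ,
      Nat.cast_add, Nat.cast_mul, ← ih]
    have h : (1 / 2 : ℝ) ^ w.length * 2 ^ w.length = 1 := by rw [← mul_pow]; norm_num
    cases b
    · simp [binNat]
      ring
    · simp only [if_true, binNat, List.foldl, pow_succ]
      push_cast
      simp only [Bool.toNat_true]
      push_cast
      linear_combination h

/-- The first `m` binary digits of the fractional part of `x`. -/
noncomputable def digitString (x : ℝ) (m : ℕ) : List Bool :=
  (List.range m).map fun j => decide (Real.digits (Int.fract x) 2 j = 1)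

theorem digitString_length (x : ℝ) (m : ℕ) : (digitString x m).length = m := by simp [digitString]

theorem binVal_digitString (x : ℝ) (m : ℕ) : binVal (digitString x m) =
    ∑ j ∈ Finset.range m, Real.ofDigitsTerm (Real.digits (Int.fract x) 2) j := by
  rw [binVal, digitString_length]
  refine Finset.sum_congr rfl fun j hj => ?_
  have hj : j < m := Finset.mem_range.1 hj
  rw [digitString, List.getD_eq_getElem _ _ (by simpa using hj)]
  simp only [List.getElem_map, List.getElem_range, Real.ofDigitsTerm]
  generalize Real.digits (Int.fract x) 2 j = b
  fin_cases b <;> simp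

theorem fract_mem_dyadicI_digitString (x : ℝ) (m : ℕ) :
    Int.fract x ∈ dyadicI (digitString x m) := by
  have hx := fract_mem_Ico x
  rw [dyadicI, digitString_length, binVal_digitString]
  refine ⟨Real.sum_ofDigitsTerm_digits_le hx m, ?_⟩
  have h1 := Real.ofDigits_digits_sum_eq (b := 2) hx m
  have h2 := Nat.lt_floor_add_one (((2 : ℕ) : ℝ) ^ m * Int.fract x)
  rw [← h1] at h2
  push_cast at h2
  have h3 : (1 / 2 : ℝ) ^ m * 2 ^ m = 1 := by rw [← mul_pow]; norm_num
  have h4 : (0 : ℝ) < 2 ^ m := by positivity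
  nlinarith

theorem digitString_mem_meshSet {N : ℕ} {F : Set (EuclideanSpace ℝ (Fin N))}
    {x : EuclideanSpace ℝ (Fin N)} (hx : x ∈ F) (m : ℕ) :
    (fun i => digitString (x i) m) ∈ meshSet F :=
  ⟨fun i j => by simp [digitString_length], fun i => Int.fract (x i),
    fun i _ => fract_mem_dyadicI_digitString (x i) m, x, hx, rfl⟩

theorem interleave_digitString {N : ℕ} [NeZero N] (x : EuclideanSpace ℝ (Fin N)) (n : ℕ) :
    interleave n (fun i => digitString (x i) (n / N + 1)) = pre (code x) n := by
  rw [interleave, pre]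
  refine List.map_congr_left fun j hj => ?_
  have h : j / N < n / N + 1 :=
    Nat.lt_succ_of_le (Nat.div_le_div_right (List.mem_range.1 hj).le)
  rw [digitString, List.getD_eq_getElem _ _ (by simpa using h)]
  simp [code]

theorem level_finite {N : ℕ} [NeZero N] {F : Set (EuclideanSpace ℝ (Fin N))}
    {L : Set (Fin N → List Bool)} (hL : L ⊆ meshSetHat F) (m : ℕ) : (level L m).Finite :=
  (Set.Finite.pi' fun _ : Fin N => List.finite_length_eq Bool m).subset
    fun _ hs i => ((hL hs.1).1 i 0).trans hs.2

/-- In units of `2^{-|s|}`, the enlarged interval is `[binNat s - 1, binNat s + 2)`, and `c` is at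
most one unit from `x`. So `binNat s` is near `⌊2^|s| c⌋` up to the wrap-around `2^|s| z`. The
bounds below leave six offsets; 8 is a convenient power of two. -/
theorem exists_binNat_eq_of_mem_dyadicIHat {s : List Bool} {x c : ℝ}
    (hx : Int.fract x ∈ dyadicIHat s) (hc : |x - c| ≤ (1 / 2 : ℝ) ^ s.length) :
    ∃ (j : Fin 8) (z : ℤ), (binNat s : ℤ) = ⌊2 ^ s.length * c⌋ + j - 3 + 2 ^ s.length * z := by
  obtain ⟨y, ⟨hy1, hy2⟩, hy⟩ := hx
  obtain ⟨z, hz⟩ := Int.fract_eq_fract.1 hy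
  have h1 : (1 / 2 : ℝ) ^ s.length * 2 ^ s.length = 1 := by rw [← mul_pow]; norm_num
  have h2 : (0 : ℝ) < 2 ^ s.length := by positivity
  have h3 := binVal_mul_two_pow s
  rw [abs_le] at hc
  generalize (1 / 2 : ℝ) ^ s.length = ε at *
  have hf1 := Int.floor_le (2 ^ s.length * c)
  have hf2 := Int.lt_floor_add_one (2 ^ s.length * c)
  generalize ⌊2 ^ s.length * c⌋ = f at *
  have hlow : ((binNat s : ℤ) : ℝ) < ((f + 2 ^ s.length * z + 3 : ℤ) : ℝ) := by
    push_cast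
    rw [← h3]
    nlinarith
  have hhigh : ((f + 2 ^ s.length * z - 4 : ℤ) : ℝ) < ((binNat s : ℤ) : ℝ) := by
    push_cast
    rw [← h3]
    nlinarith
  have hlow := Int.cast_lt.1 hlow
  have hhigh := Int.cast_lt.1 hhigh
  refine ⟨⟨((binNat s : ℤ) - f - 2 ^ s.length * z + 3).toNat, by omega⟩, z, ?_⟩
  simp only
  rw [Int.toNat_of_nonneg (by omega)]
  ring

theorem abs_apply_sub_le_dist {N : ℕ} (x y : EuclideanSpace ℝ (Fin N)) (i : Fin N) :
    |x i - y i| ≤ dist x y := by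
  rw [dist_eq_norm]
  exact PiLp.norm_apply_le (x - y) i

/-- A ball centre and the `N` offsets determine each `binNat (s i)` modulo `2^m`, hence `s i`
itself, since `binNat (s i) < 2^m`. -/
theorem ncard_level_le {N : ℕ} [NeZero N] {F : Set (EuclideanSpace ℝ (Fin N))}
    {L : Set (Fin N → List Bool)} (hL : L ⊆ meshSetHat F) {m : ℕ}
    {C : Set (EuclideanSpace ℝ (Fin N))} (hC : Metric.IsCover ((1 / 2) ^ m) F C)
    (hfin : C.Finite) : (level L m).ncard ≤ C.ncard * 8 ^ N := by
  have h : ∀ s ∈ level L m, ∃ p : EuclideanSpace ℝ (Fin N) × (Fin N → Fin 8), p.1 ∈ C ∧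
      ∀ i, (s i).length = m ∧ ∃ z : ℤ,
        (binNat (s i) : ℤ) = ⌊2 ^ m * p.1 i⌋ + p.2 i - 3 + 2 ^ m * z := by
    rintro s ⟨hs, hsm⟩
    obtain ⟨hlen, y, hy, x, hx, rfl⟩ := hL hs
    have hlen : ∀ i, (s i).length = m := fun i => (hlen i 0).trans hsm
    obtain ⟨c, hc, hxc⟩ := hC hx
    have hdist : dist x c ≤ (1 / 2 : ℝ) ^ m := by
      have h1 : edist x c ≤ (((1 / 2) ^ m : ℝ≥0) : ℝ≥0∞) := hxc
      rw [edist_nndist, ENNReal.coe_le_coe] at h1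
      exact_mod_cast h1
    have key : ∀ i, ∃ (j : Fin 8) (z : ℤ),
        (binNat (s i) : ℤ) = ⌊2 ^ m * c i⌋ + j - 3 + 2 ^ m * z := fun i => by
      have h2 := exists_binNat_eq_of_mem_dyadicIHat (c := c i) (hy i (Set.mem_univ i))
        (by rw [hlen]; exact (abs_apply_sub_le_dist x c i).trans hdist)
      rwa [hlen] at h2
    choose j hj using key
    exact ⟨(c, j), hc, fun i => ⟨hlen i, hj i⟩⟩
  choose! p hpC hp using h
  have hinj : Set.InjOn p (level L m) := by
    intro s hs s' hs' hss
    funext i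
    obtain ⟨hl, z, hz⟩ := hp s hs i
    obtain ⟨hl', z', hz'⟩ := hp s' hs' i
    refine binNat_injOn (hl.trans hl'.symm) ?_
    rw [hss] at hz
    have h1 := binNat_lt (s i)
    have h2 := binNat_lt (s' i)
    rw [hl] at h1
    rw [hl'] at h2
    have hmod : (binNat (s i) : ℤ) ≡ binNat (s' i) [ZMOD ((2 ^ m : ℕ) : ℤ)] := by
      rw [Int.modEq_iff_dvd]
      refine ⟨z' - z, ?_⟩
      push_cast
      linear_combination hz' - hz
    exact (Int.natCast_modEq_iff.1 hmod).eq_of_lt_of_lt h1 h2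
  calc (level L m).ncard ≤ (C ×ˢ (Set.univ : Set (Fin N → Fin 8))).ncard :=
        Set.ncard_le_ncard_of_injOn p (fun s hs => ⟨hpC s hs, Set.mem_univ _⟩) hinj
          (hfin.prod Set.finite_univ)
    _ = C.ncard * 8 ^ N := by
        rw [Set.ncard_prod, Set.ncard_univ]
        simp

theorem exists_cover_of_upperBoxDim_lt {N : ℕ} {F : Set (EuclideanSpace ℝ (Fin N))} {D : ℝ}
    (h : upperBoxDim F < (D : EReal)) :
    ∀ᶠ m : ℕ in atTop, ∃ C : Set (EuclideanSpace ℝ (Fin N)), C.Finite ∧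
      Metric.IsCover ((1 / 2) ^ m) F C ∧ (C.ncard : ℝ) ≤ 2 ^ (m * D) := by
  have h1 := eventually_lt_of_limsup_lt h
  have h2 : Tendsto (fun m : ℕ => (1 / 2 : ℝ≥0) ^ m) atTop (𝓝[>] 0) := by
    refine tendsto_nhdsWithin_iff.2 ⟨?_, Eventually.of_forall fun m => ?_⟩
    · refine tendsto_pow_atTop_nhds_zero_of_lt_one zero_le ?_
      rw [← NNReal.coe_lt_coe]
      norm_num
    · exact pow_pos (by norm_num : (0 : ℝ≥0) < 1 / 2) m
  filter_upwards [h2.eventually h1, eventually_gt_atTop 0] with m hm hpos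
  have hlog : -Real.log (((1 / 2 : ℝ≥0) ^ m : ℝ≥0) : ℝ) = m * Real.log 2 := by
    push_cast
    rw [Real.log_pow, one_div, Real.log_inv]
    ring
  have hlt : (0 : ℝ) < m * Real.log 2 := mul_pos (Nat.cast_pos.2 hpos) (Real.log_pos one_lt_two)
  rw [hlog, EReal.div_lt_iff (EReal.coe_pos.2 hlt) (EReal.coe_ne_top _), ← EReal.coe_mul] at hm
  have hval : ((D * (m * Real.log 2) : ℝ) : EReal) =
      ENNReal.log (ENNReal.ofReal ((2 : ℝ) ^ (m * D))) := by
    rw [ENNReal.log_ofReal_of_pos (by positivity), Real.log_rpow two_pos]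
    congr 1
    ring
  rw [hval, ENNReal.log_lt_log_iff] at hm
  obtain ⟨C, hC, hcard⟩ : ∃ C : Set (EuclideanSpace ℝ (Fin N)),
      Metric.IsCover ((1 / 2) ^ m) F C ∧
        C.encard = Metric.externalCoveringNumber ((1 / 2) ^ m) F := by
    have h3 : Metric.externalCoveringNumber ((1 / 2 : ℝ≥0) ^ m) F =
        ⨅ C : {C : Set (EuclideanSpace ℝ (Fin N)) // Metric.IsCover ((1 / 2) ^ m) F C},
          C.1.encard := by
      rw [Metric.externalCoveringNumber, iInf_subtype]
    -- `F` covers itself, so the infimum is over a nonempty family and is attained in `ℕ∞`.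
    have : Nonempty {C : Set (EuclideanSpace ℝ (Fin N)) // Metric.IsCover ((1 / 2) ^ m) F C} :=
      ⟨⟨F, fun x hx => ⟨x, hx, by simp⟩⟩⟩
    obtain ⟨C, hC⟩ := ENat.exists_eq_iInf fun C : {C : Set (EuclideanSpace ℝ (Fin N)) //
      Metric.IsCover ((1 / 2) ^ m) F C} => C.1.encard
    exact ⟨C.1, C.2, by rw [h3, hC]⟩
  rw [← hcard] at hm
  have hfin : C.Finite := by
    rw [← Set.encard_ne_top_iff]
    intro ht
    rw [ht] at hm
    simp at hm
  refine ⟨C, hfin, hC, ?_⟩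
  rw [← hfin.cast_ncard_eq, ENat.toENNReal_coe, ← ENNReal.ofReal_natCast,
    ENNReal.ofReal_lt_ofReal_iff (by positivity)] at hm
  exact hm.le

/-! ### Compressibility of points of a set of small box dimension -/

/-- Under the r.e. condition, the points of a set are compressible at any rate above its box
dimension. -/
theorem eventually_complexity_le {U : List Bool →. List Bool} (hU : IsOptimalComputer U)
    {N : ℕ} [NeZero N] {F : Set (EuclideanSpace ℝ (Fin N))} (hre : RECondition F) {D θ : ℝ}
    (hD0 : 0 ≤ D) (hD : upperBoxDim F ≤ (D : EReal)) (hθ : D / N < θ)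
    {x : EuclideanSpace ℝ (Fin N)} (hx : x ∈ F) :
    (∀ n, complexity U (pre (code x) n) ≠ ⊤) ∧
      ∀ᶠ n : ℕ in atTop, ((complexity U (pre (code x) n)).toNat : ℝ) ≤ θ * n := by
  have hN : (0 : ℝ) < N := Nat.cast_pos.2 (NeZero.pos N)
  obtain ⟨L, hL, hML, hLM⟩ := hre
  obtain ⟨c, hc⟩ := exists_complexity_interleave_le hU hL (level_finite hLM)
  have hle : ∀ n a : ℕ, n < 2 ^ a → (level L (n / N + 1)).ncard * 2 ^ a ≤ 2 ^ (a * a) →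
      complexity U (pre (code x) n) ≤ (a * a + a + 1 + c : ℕ) := by
    intro n a hn ha
    rw [← interleave_digitString x n]
    exact hc n a hn ha _ ⟨hML (digitString_mem_meshSet hx _), digitString_length _ _⟩
  constructor
  · intro n
    -- Only finiteness is wanted here, so a crude header length `n + k + 2` is enough.
    let k := (level L (n / N + 1)).ncard
    have h1 : n < 2 ^ (n + k + 2) := Nat.lt_two_pow_self.trans_le
      (Nat.pow_le_pow_right two_pos (by omega))
    have h2 : k * 2 ^ (n + k + 2) ≤ 2 ^ ((n + k + 2) * (n + k + 2)) := by
      calc k * 2 ^ (n + k + 2) ≤ 2 ^ k * 2 ^ (n + k + 2) :=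
            Nat.mul_le_mul_right _ Nat.lt_two_pow_self.le
        _ = 2 ^ (k + (n + k + 2)) := (pow_add _ _ _).symm
        _ ≤ _ := Nat.pow_le_pow_right two_pos (by nlinarith)
    exact ne_top_of_le_ne_top (ENat.natCast_ne_top _) (hle n _ h1 h2)
  -- With `a = ⌈√(ϑn)⌉` the payload has about `ϑn` bits. The gap `D' < ϑN` leaves room for storing
  -- `n` and the constant factors, the gap `ϑ < θ` for the header and the rounding.
  · obtain ⟨ϑ, hDϑ, hϑθ⟩ := exists_between hθ
    have hϑ : 0 < ϑ := (div_nonneg hD0 hN.le).trans_lt hDϑ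
    obtain ⟨D', hDD', hD'ϑ⟩ := exists_between ((div_lt_iff₀ hN).1 hDϑ)
    have hcover := exists_cover_of_upperBoxDim_lt
      (hD.trans_lt (EReal.coe_lt_coe_iff.2 hDD'))
    have hm : Tendsto (fun n : ℕ => n / N + 1) atTop atTop :=
      tendsto_atTop_mono (fun n => Nat.le_succ (n / N)) (Nat.tendsto_div_const_atTop (NeZero.ne N))
    let t : ℕ → ℝ := fun n => √(ϑ * n)
    have ht : Tendsto t atTop atTop :=
      Real.tendsto_sqrt_atTop.comp (tendsto_natCast_atTop_atTop.const_mul_atTop hϑ)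
    have hceil : Tendsto (fun n => ⌈t n⌉₊) atTop atTop := tendsto_nat_ceil_atTop.comp ht
    have hexp : ∀ᶠ a : ℕ in atTop, (a : ℝ) ^ 2 / 2 ^ a < ϑ :=
      (tendsto_pow_const_div_const_pow_of_one_lt 2 one_lt_two).eventually (gt_mem_nhds hϑ)
    have hquad : ∀ {κ : ℝ} (A B : ℝ), 0 < κ → ∀ᶠ y : ℝ in atTop, A * y + B ≤ κ * y ^ 2 := by
      intro κ A B hκ
      filter_upwards [eventually_ge_atTop (1 : ℝ), eventually_ge_atTop ((|A| + |B|) / κ)]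
        with y hy1 hy2
      rw [div_le_iff₀ hκ] at hy2
      have h1 : A * y ≤ |A| * y := by gcongr; exact le_abs_self A
      have h2 : B ≤ |B| * y := (le_abs_self B).trans (le_mul_of_one_le_right (abs_nonneg B) hy1)
      nlinarith
    have hκ₁ : 0 < 1 - D' / N / ϑ := by
      rw [sub_pos, div_lt_one hϑ, div_lt_iff₀ hN]
      exact hD'ϑ
    have hκ₂ : 0 < (θ - ϑ) / ϑ := div_pos (sub_pos.2 hϑθ) hϑ
    -- Since `a < t + 1`, the first quadratic bound absorbs the excess `D' + 3N + a` in the exponent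
    -- of the level size, and the second comes from `a² + a + 1 + c ≤ t² + 3t + 3 + c`.
    filter_upwards [hm.eventually hcover, hceil.eventually hexp,
      ht.eventually (hquad 1 (3 * N + D' + 1) hκ₁), ht.eventually (hquad 3 (3 + c) hκ₂)]
      with n ⟨C, hCfin, hC, hCcard⟩ h1 h2 h3
    have ht0 : 0 ≤ t n := Real.sqrt_nonneg _
    have htsq : t n ^ 2 = ϑ * n := Real.sq_sqrt (by positivity)
    have ha1 : t n ≤ ⌈t n⌉₊ := Nat.le_ceil _
    have ha2 : (⌈t n⌉₊ : ℝ) < t n + 1 := Nat.ceil_lt_add_one ht0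
    generalize ⌈t n⌉₊ = a at *
    have hn : n < 2 ^ a := by
      rw [div_lt_iff₀ (by positivity)] at h1
      have h4 : ϑ * n < ϑ * 2 ^ a := by nlinarith
      exact_mod_cast lt_of_mul_lt_mul_left h4 hϑ.le
    have hcard : (level L (n / N + 1)).ncard * 2 ^ a ≤ 2 ^ (a * a) := by
      have h5 : (((level L (n / N + 1)).ncard : ℕ) : ℝ) ≤ C.ncard * 8 ^ N := by
        exact_mod_cast ncard_level_le hLM hC hCfin
      have h6 : (((level L (n / N + 1)).ncard * 2 ^ a : ℕ) : ℝ) ≤ ((2 ^ (a * a) : ℕ) : ℝ) := by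
        push_cast
        calc (((level L (n / N + 1)).ncard : ℕ) : ℝ) * 2 ^ a
            ≤ (2 ^ (((n / N + 1 : ℕ) : ℝ) * D') * 8 ^ N) * 2 ^ a := by
              gcongr
              exact h5.trans (by gcongr)
          _ = 2 ^ (((n / N + 1 : ℕ) : ℝ) * D' + 3 * N + a) := by
              rw [Real.rpow_add two_pos, Real.rpow_add two_pos, Real.rpow_natCast,
                Real.rpow_mul two_pos.le 3, Real.rpow_natCast]
              norm_num
          _ ≤ 2 ^ ((a * a : ℕ) : ℝ) := by
              refine Real.rpow_le_rpow_of_exponent_le one_le_two ?_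
              have h7 : ((n / N + 1 : ℕ) : ℝ) * D' ≤ (n / N + 1) * D' := by
                push_cast
                gcongr
                · exact hD0.trans hDD'.le
                · exact Nat.cast_div_le
              have h8 : (1 - D' / N / ϑ) * t n ^ 2 = t n ^ 2 - n / N * D' := by
                rw [htsq]
                field_simp
              rw [h8] at h2
              have h9 := mul_self_le_mul_self ht0 ha1
              rw [add_mul] at h7
              rw [Nat.cast_mul]
              linarith
          _ = 2 ^ (a * a) := Real.rpow_natCast _ _
      exact_mod_cast h6
    have h9 : (complexity U (pre (code x) n)).toNat ≤ a * a + a + 1 + c :=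
      ENat.toNat_le_of_le_natCast (hle n a hn hcard)
    have h10 : ((complexity U (pre (code x) n)).toNat : ℝ) ≤ a * a + a + 1 + c := by
      exact_mod_cast h9
    have h11 : (θ - ϑ) / ϑ * t n ^ 2 = θ * n - t n ^ 2 := by
      rw [htsq]
      field_simp
    rw [h11] at h3
    nlinarith

theorem isCompressible_of_mem {U : List Bool →. List Bool} (hU : IsOptimalComputer U)
    {N : ℕ} [NeZero N] {F : Set (EuclideanSpace ℝ (Fin N))} (hre : RECondition F) {D : ℝ}
    (hD0 : 0 ≤ D) (hD : upperBoxDim F ≤ (D : EReal)) {x : EuclideanSpace ℝ (Fin N)} (hx : x ∈ F) :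
    IsCompressible U (D / N) (code x) := by
  have key := fun θ hθ => eventually_complexity_le hU hre hD0 hD (θ := θ) hθ hx
  have hne := (key (D / N + 1) (by linarith)).1
  -- Truncation at zero gives the lower half of the limit for free.
  refine ⟨fun n => max 0 ((complexity U (pre (code x) n)).toNat - D / N * n), ?_, fun n => ?_⟩
  · rw [tendsto_order]
    constructor
    · intro ε hε
      exact Eventually.of_forall fun n => hε.trans_le (by positivity)
    · intro ε hε
      filter_upwards [(key (D / N + ε / 2) (by linarith)).2, eventually_gt_atTop 0] with n hn hpos
      have hn0 : (0 : ℝ) < n := Nat.cast_pos.2 hpos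
      rw [div_lt_iff₀ hn0, max_lt_iff]
      constructor <;> nlinarith [mul_pos hε hn0]
  · rw [complexityE_eq_coe_toNat (hne n), EReal.coe_le_coe_iff]
    have := le_max_right 0 (((complexity U (pre (code x) n)).toNat : ℝ) - D / N * n)
    linarith

end AlgDim

/-! ### The algorithmic dimensions of `F` -/

theorem mainTheorem8
    (U : List Bool →. List Bool) (hU : AlgDim.IsOptimalComputer U)
    {N : ℕ} [NeZero N] (F : Set (EuclideanSpace ℝ (Fin N))) (hF : F.Nonempty)
    (hbdd : Bornology.IsBounded F) (hre : AlgDim.RECondition F)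
    (D : ℝ≥0) (hD : dimH F = (D : ℝ≥0∞))
    (hdim : ((dimH F : ℝ≥0∞) : EReal) = AlgDim.upperBoxDim F) :
    AlgDim.IsAlgDim4 U F D ∧
    (0 < μH[(D : ℝ)] F → AlgDim.IsAlgDim3 U F D) ∧
    (0 < μH[(D : ℝ)] F → AlgDim.IsComputableReal D →
      AlgDim.IsAlgDim1 U F D ∧ AlgDim.IsAlgDim2 U F D) := by
  have hN : (0 : ℝ) < N := Nat.cast_pos.2 (NeZero.pos N)
  have hbox : AlgDim.upperBoxDim F ≤ ((D : ℝ) : EReal) := by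
    rw [← hdim, hD]
    rfl
  have hcomp : ∀ x ∈ F, AlgDim.IsCompressible U (D / N) (AlgDim.code x) := fun x hx =>
    AlgDim.isCompressible_of_mem hU hre D.2 hbox hx
  have hd0 : (0 : ℝ) ≤ D / N := div_nonneg D.2 hN.le
  have hrandom : 0 < μH[(D : ℝ)] F →
      ∃ x ∈ F, AlgDim.IsChaitinRandom U (D / N) (AlgDim.code x) := fun h =>
    AlgDim.exists_isChaitinRandom hU.1 hd0 (by rwa [div_mul_cancel₀ _ hN.ne'])
  refine ⟨⟨hcomp, fun d hd => ?_⟩, fun h => ⟨hcomp, ?_⟩, fun h _ => ⟨⟨hcomp, hrandom h⟩, hcomp, ?_⟩⟩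
  · rcases lt_or_ge d 0 with hneg | hnn
    · obtain ⟨x, hx⟩ := hF
      exact ⟨x, hx, AlgDim.isChaitinRandom_of_neg hneg _⟩
    -- Here `d * N < dimH F`, so the `d * N`-dimensional measure is infinite, even if `𝓗^D(F) = 0`.
    · refine AlgDim.exists_isChaitinRandom hU.1 hnn ?_
      obtain ⟨e, he⟩ : ∃ e : ℝ≥0, (e : ℝ) = d * N := ⟨⟨d * N, by positivity⟩, rfl⟩
      have hlt : (e : ℝ≥0∞) < dimH F := by
        rw [hD, ENNReal.coe_lt_coe, ← NNReal.coe_lt_coe, he]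
        exact (lt_div_iff₀ hN).1 hd
      rw [← he, hausdorffMeasure_of_lt_dimH hlt]
      exact ENNReal.zero_lt_top
  · obtain ⟨x, hx, hr⟩ := hrandom h
    exact ⟨x, hx, hr.isSemiRandom⟩
  · obtain ⟨x, hx, hr⟩ := hrandom h
    exact ⟨x, hx, hr.isWeaklyChaitinRandom hd0⟩
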